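/- For a positive integer $n$ let $C_n=\{z\in\mathbb C: z^n=1\}$ be the multiplicative cyclic group of order $n$. A subset $B\subseteq C_n$ is called a difference basis of $C_n$ if every $g\in C_n$ can be written as $g=xy^{-1}$ with $x,y\in B$. Let $\Delta[C_n]$ be the smallest cardinality of a difference basis of $C_n$, and let $\eth[C_n]=\Delta[C_n]/\sqrt{n}$. Then $$\lim_{q\to\infty}\eth[C_{q^2+q+1}]=\lim_{q\to\infty}\eth[C_{q^2-1}]=\lim_{p\to\infty}\eth[C_{p^2-p}]=1,$$ where $q$ tends to infinity through the prime powers (the numbers $r^k$ with $r$ prime and $k\ge1$) and $p$ tends to infinity through the prime numbers. -/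

import Mathlib

/-- `B` is a difference basis for the subset `A` of the group `G`: every `a ∈ A` can be written
as `a = x * y⁻¹` with `x, y ∈ B`. -/
def IsDifferenceBasis {G : Type*} [Group G] (B A : Set G) : Prop :=
  ∀ a ∈ A, ∃ x ∈ B, ∃ y ∈ B, a = x * y⁻¹

/-- The difference size `Δ[A]`: the smallest cardinality of a difference basis for `A` in `G`.
It is intended for finite `A`, where a finite difference basis always exists (so that the infimum,
taken in `ℕ`, is a minimum). -/
noncomputable def differenceSize {G : Type*} [Group G] (A : Set G) : ℕ :=
  sInf {k : ℕ | ∃ B : Finset G, IsDifferenceBasis (B : Set G) A ∧ B.card = k}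

/-- The difference characteristic `ð[A] = Δ[A] / √|A|` of a (nonempty finite) subset `A` of `G`. -/
noncomputable def differenceChar {G : Type*} [Group G] (A : Set G) : ℝ :=
  (differenceSize A : ℝ) / Real.sqrt (A.ncard : ℝ)

/-- The difference characteristic `ð[C_n]` of the group `C_n = {z ∈ ℂ : z ^ n = 1}` (the cyclic
group of order `n` when `n ≥ 1`), as a subset of itself. -/
noncomputable def cyclicDifferenceChar (n : ℕ) : ℝ :=
  differenceChar (Set.univ : Set (rootsOfUnity n ℂ))

/-!
The lower bound `ð[C_n] ≥ 1` is pure counting: if the quotients `x * y⁻¹` with `x, y ∈ B` exhaust a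
group `G`, then `|G| ≤ |B| ^ 2` (`card_le_differenceSize_sq`). For the upper bounds it suffices, in
each of the three families, to find a cyclic group of the right order with a difference basis of at
most `q + 4 √q + 4` elements, as the order is at least `q ^ 2 - q`
(`tendsto_cyclicDifferenceChar`). The bases come from finite geometry.

* Singer: let `K / F` be a cubic extension of finite fields with `|F| = q`, and `θ ∈ K ∖ F`. Any two
  `F`-planes in `K` meet nontrivially, so each `u ∈ Kˣ` is a quotient of nonzero elements of
  the plane `F + F θ`. Modulo `Fˣ` such elements are `1` or `θ + c` with `c ∈ F`, and these are a
  difference basis of `Kˣ / Fˣ` of `q + 1` elements (`differenceSize_singer_le`).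
* Bose: let `K / F` be quadratic and `θ ∈ K ∖ F`. If `u ∈ K ∖ F`, then `1, u` is an `F`-basis of
  `K`, so that `u (θ + c) = θ + d` is solvable in `F`. Hence the `q` elements `θ + c` are a difference
  basis for `Kˣ ∖ Fˣ` (`differenceSize_bose_le`).
* Ruzsa: in `Fˣ × F` with `F = ZMod p`, the graph of the inclusion of `Fˣ` in `F` is a difference
  basis for the pairs `(a, b)` with `a ≠ 1` and `b ≠ 0` (`differenceSize_ruzsa_le`).

The exceptional elements of the last two constructions lie in one or two cyclic subgroups of order
at most `q`, each of which is covered by `O(√q)` elements (`differenceSize_zpowers_le`).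
-/

/-! ### Difference sizes of subsets of groups -/

section DifferenceSize

variable {G H : Type*} [Group G] [Group H]

lemma differenceSize_le_card {A : Set G} (B : Finset G) (h : IsDifferenceBasis (B : Set G) A) :
    differenceSize A ≤ B.card :=
  Nat.sInf_le ⟨B, h, rfl⟩

lemma exists_isDifferenceBasis_card_eq [Finite G] (A : Set G) :
    ∃ B : Finset G, IsDifferenceBasis (B : Set G) A ∧ B.card = differenceSize A := by
  have := Fintype.ofFinite G
  have hne : {k : ℕ | ∃ B : Finset G, IsDifferenceBasis (B : Set G) A ∧ B.card = k}.Nonempty :=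
    ⟨_, Finset.univ, fun a _ => ⟨a, by simp, 1, by simp, by simp⟩, rfl⟩
  exact Nat.sInf_mem hne

lemma differenceSize_mono [Finite G] {A A' : Set G} (h : A ⊆ A') :
    differenceSize A ≤ differenceSize A' := by
  obtain ⟨B, hB, hc⟩ := exists_isDifferenceBasis_card_eq A'
  exact hc ▸ differenceSize_le_card B fun a ha => hB a (h ha)

lemma differenceSize_union_le [Finite G] (A A' : Set G) :
    differenceSize (A ∪ A') ≤ differenceSize A + differenceSize A' := by
  classical
  obtain ⟨B, hB, hc⟩ := exists_isDifferenceBasis_card_eq A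
  obtain ⟨B', hB', hc'⟩ := exists_isDifferenceBasis_card_eq A'
  rw [← hc, ← hc']
  refine (differenceSize_le_card (B ∪ B') ?_).trans (Finset.card_union_le B B')
  rintro a (ha | ha)
  · obtain ⟨x, hx, y, hy, rfl⟩ := hB a ha
    exact ⟨x, by simp_all, y, by simp_all, rfl⟩
  · obtain ⟨x, hx, y, hy, rfl⟩ := hB' a ha
    exact ⟨x, by simp_all, y, by simp_all, rfl⟩

lemma differenceSize_univ_le_of_surjective [Finite G] (f : G →* H) (hf : Function.Surjective f) :
    differenceSize (Set.univ : Set H) ≤ differenceSize (Set.univ : Set G) := by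
  classical
  obtain ⟨B, hB, hc⟩ := exists_isDifferenceBasis_card_eq (Set.univ : Set G)
  rw [← hc]
  refine (differenceSize_le_card (B.image f) fun b _ => ?_).trans Finset.card_image_le
  obtain ⟨a, rfl⟩ := hf b
  obtain ⟨x, hx, y, hy, rfl⟩ := hB a trivial
  exact ⟨f x, by simpa using ⟨x, hx, rfl⟩, f y, by simpa using ⟨y, hy, rfl⟩, by simp⟩

lemma card_le_differenceSize_sq [Finite G] :
    Nat.card G ≤ differenceSize (Set.univ : Set G) ^ 2 := by
  obtain ⟨B, hB, hc⟩ := exists_isDifferenceBasis_card_eq (Set.univ : Set G)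
  have hs : Function.Surjective (fun z : B × B => (z.1 : G) * (z.2 : G)⁻¹) := fun a => by
    obtain ⟨x, hx, y, hy, rfl⟩ := hB a trivial
    exact ⟨(⟨x, hx⟩, ⟨y, hy⟩), rfl⟩
  calc Nat.card G ≤ Nat.card (B × B) := Nat.card_le_card_of_surjective _ hs
    _ = _ := by rw [Nat.card_prod, Nat.card_eq_fintype_card, Fintype.card_coe, hc, sq]

/-- With `s = √(orderOf g) + 1`, writing an exponent below `s ^ 2` in base `s` shows that the
powers `g ^ (s * i)` and `g ^ (-j)` with `i, j < s` suffice. -/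
lemma differenceSize_zpowers_le [Finite G] (g : G) :
    differenceSize (Subgroup.zpowers g : Set G) ≤ 2 * (Nat.sqrt (orderOf g) + 1) := by
  classical
  set s := Nat.sqrt (orderOf g) + 1 with hs
  refine (differenceSize_le_card ((Finset.range s).image (fun i => g ^ (s * i)) ∪
    (Finset.range s).image (fun j => (g ^ j)⁻¹)) fun a ha => ?_).trans ?_
  · obtain ⟨k, hk, rfl⟩ :=
      (mem_zpowers_iff_mem_range_orderOf.mp ha : a ∈ (Finset.range (orderOf g)).image (g ^ ·))
        |> Finset.mem_image.mp
    have hks : k < s * s := (Finset.mem_range.mp hk).trans (Nat.lt_succ_sqrt _)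
    refine ⟨g ^ (s * (k / s)), ?_, (g ^ (k % s))⁻¹, ?_, ?_⟩
    · have : k / s < s := Nat.div_lt_of_lt_mul hks
      simp only [Finset.coe_union, Finset.coe_image, Set.mem_union, Set.mem_image]
      exact Or.inl ⟨k / s, by simpa using this, rfl⟩
    · have : k % s < s := Nat.mod_lt _ (Nat.succ_pos _)
      simp only [Finset.coe_union, Finset.coe_image, Set.mem_union, Set.mem_image]
      exact Or.inr ⟨k % s, by simpa using this, rfl⟩
    · rw [inv_inv, ← pow_add, Nat.div_add_mod]
  · refine (Finset.card_union_le _ _).trans ?_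
    have h1 := Finset.card_image_le (s := Finset.range s) (f := fun i => g ^ (s * i))
    have h2 := Finset.card_image_le (s := Finset.range s) (f := fun j => (g ^ j)⁻¹)
    rw [Finset.card_range] at h1 h2
    omega

/-- The difference size of the group of `n`-th roots of unity may be computed in any cyclic
group of order `n`. -/
lemma differenceSize_rootsOfUnity_le [Finite G] [IsCyclic G] {n : ℕ} (hn : n ≠ 0)
    (h : Nat.card G = n) :
    differenceSize (Set.univ : Set (rootsOfUnity n ℂ)) ≤ differenceSize (Set.univ : Set G) := by
  have : NeZero n := ⟨hn⟩
  let e : G ≃* rootsOfUnity n ℂ :=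
    mulEquivOfCyclicCardEq (h.trans (Complex.card_rootsOfUnity n).symm)
  exact differenceSize_univ_le_of_surjective e.toMonoidHom e.surjective

end DifferenceSize

/-! ### Singer's difference bases -/

section Extension

variable {F K : Type*} [Field F] [Field K] [Algebra F K]

lemma eq_zero_of_add_mul_eq_zero {θ : K} (hθ : θ ∉ Set.range (algebraMap F K)) {a b : F}
    (h : algebraMap F K a + algebraMap F K b * θ = 0) : a = 0 ∧ b = 0 := by
  have hb : b = 0 := by
    by_contra hb
    have hb' : algebraMap F K b ≠ 0 := by simpa using hb
    refine hθ ⟨-a / b, ?_⟩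
    rw [map_div₀, map_neg]
    field_simp
    linear_combination -h
  subst hb
  simpa using h

lemma add_algebraMap_ne_zero {θ : K} (hθ : θ ∉ Set.range (algebraMap F K)) (c : F) :
    θ + algebraMap F K c ≠ 0 := fun h =>
  hθ ⟨-c, by rw [map_neg]; linear_combination -h⟩

lemma exists_notMem_range_algebraMap (h : 1 < Module.finrank F K) :
    ∃ θ : K, θ ∉ Set.range (algebraMap F K) := by
  by_contra! hall
  have : Module.finrank F K ≤ 1 := finrank_le_one (1 : K) fun w => by
    obtain ⟨c, hc⟩ := hall w
    exact ⟨c, by rw [Algebra.smul_def, mul_one, hc]⟩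
  omega

/-- In a cubic extension the planes `u • (F + F θ)` and `F + F θ` meet nontrivially. -/
lemma exists_mul_add_eq_add (h3 : Module.finrank F K = 3) {θ : K}
    (hθ : θ ∉ Set.range (algebraMap F K)) (u : Kˣ) :
    ∃ a b c d : F, algebraMap F K a + algebraMap F K b * θ ≠ 0 ∧
      u * (algebraMap F K a + algebraMap F K b * θ) = algebraMap F K c + algebraMap F K d * θ := by
  have : FiniteDimensional F K := FiniteDimensional.of_finrank_pos (by omega)
  let L : ((F × F) × (F × F)) →ₗ[F] K :=
    { toFun := fun x => u * (algebraMap F K x.1.1 + algebraMap F K x.1.2 * θ) -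
        (algebraMap F K x.2.1 + algebraMap F K x.2.2 * θ)
      map_add' := fun x y => by
        simp only [Prod.fst_add, Prod.snd_add, map_add]; ring
      map_smul' := fun r x => by
        simp only [Prod.smul_fst, Prod.smul_snd, smul_eq_mul, map_mul, RingHom.id_apply]
        rw [Algebra.smul_def]
        ring }
  have hL : LinearMap.ker L ≠ ⊥ := L.ker_ne_bot_of_finrank_lt (by
    simp only [Module.finrank_prod, Module.finrank_self, h3]; norm_num)
  obtain ⟨⟨⟨a, b⟩, ⟨c, d⟩⟩, hx, hx0⟩ := (Submodule.ne_bot_iff _).mp hL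
  have hx' : u * (algebraMap F K a + algebraMap F K b * θ) =
      algebraMap F K c + algebraMap F K d * θ := sub_eq_zero.mp hx
  refine ⟨a, b, c, d, fun h0 => hx0 ?_, hx'⟩
  obtain ⟨rfl, rfl⟩ := eq_zero_of_add_mul_eq_zero hθ h0
  rw [h0, mul_zero] at hx'
  obtain ⟨rfl, rfl⟩ := eq_zero_of_add_mul_eq_zero hθ hx'.symm
  rfl

lemma differenceSize_singer_le [Finite F] (h3 : Module.finrank F K = 3) :
    differenceSize (Set.univ : Set (Kˣ ⧸ (Units.map (algebraMap F K : F →* K)).range)) ≤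
      Nat.card F + 1 := by
  classical
  have := Fintype.ofFinite F
  obtain ⟨θ, hθ⟩ := exists_notMem_range_algebraMap (F := F) (K := K) (by omega)
  set N := (Units.map (algebraMap F K : F →* K)).range with hN
  let π : Kˣ →* Kˣ ⧸ N := QuotientGroup.mk' N
  let v : F → Kˣ := fun c => Units.mk0 _ (add_algebraMap_ne_zero hθ c)
  let B : Finset (Kˣ ⧸ N) := insert 1 (Finset.univ.image fun c => π (v c))
  have hπ (r : F) (hr : r ≠ 0) (x y : Kˣ) (hxy : (x : K) = algebraMap F K r * y) :
      π x = π y := by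
    refine (QuotientGroup.eq.mpr ?_ : (y : Kˣ ⧸ N) = x).symm
    exact ⟨Units.mk0 r hr, Units.ext (by simp [hxy, mul_comm])⟩
  -- Every nonzero element of the plane `F + F θ` is an `F`-multiple of `1` or of some `θ + c`.
  have hmem (x : Kˣ) (a b : F) (hx : (x : K) = algebraMap F K a + algebraMap F K b * θ) :
      π x ∈ B := by
    by_cases hb : b = 0
    · subst hb
      have ha : a ≠ 0 := by
        rintro rfl
        simp at hx
      rw [hπ a ha x 1 (by simpa using hx), map_one]
      exact Finset.mem_insert_self _ _
    · have hb' : algebraMap F K b ≠ 0 := by simpa using hb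
      rw [hπ b hb x (v (a / b)) (by
        simp only [v, Units.val_mk0, map_div₀]
        rw [hx]; field_simp; ring)]
      exact Finset.mem_insert_of_mem (Finset.mem_image_of_mem _ (Finset.mem_univ _))
  refine (differenceSize_le_card B fun g _ => ?_).trans ?_
  · obtain ⟨u, rfl⟩ := QuotientGroup.mk'_surjective N g
    obtain ⟨a, b, c, d, h0, h⟩ := exists_mul_add_eq_add h3 hθ u
    refine ⟨π (u * Units.mk0 _ h0), hmem _ c d (by simpa using h),
      π (Units.mk0 _ h0), hmem _ a b rfl, ?_⟩
    rw [map_mul, mul_inv_cancel_right]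
  · refine (Finset.card_insert_le _ _).trans (Nat.add_le_add_right ?_ 1)
    exact Finset.card_image_le.trans (by simp)

lemma card_units_quotient [Finite K] (h3 : Module.finrank F K = 3) :
    Nat.card (Kˣ ⧸ (Units.map (algebraMap F K : F →* K)).range) =
      Nat.card F ^ 2 + Nat.card F + 1 := by
  have : Finite F := Finite.of_injective _ (algebraMap F K).injective
  have : Module.Finite F K := .of_finite
  have hinj : Function.Injective (Units.map (algebraMap F K : F →* K)) :=
    Units.map_injective (algebraMap F K).injective
  have hq : 1 < Nat.card F := Finite.one_lt_card
  have hcard := (Units.map (algebraMap F K : F →* K)).range.index_mul_card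
  rw [Nat.card_congr (MonoidHom.ofInjective hinj).toEquiv.symm, Nat.card_units,
    Nat.card_units, Module.natCard_eq_pow_finrank (K := F) (V := K), h3] at hcard
  change (Units.map (algebraMap F K : F →* K)).range.index = _
  obtain ⟨m, hm⟩ : ∃ m, Nat.card F = m + 1 := ⟨Nat.card F - 1, by omega⟩
  rw [hm] at hcard hq ⊢
  have h1 : (m + 1) ^ 3 - 1 = ((m + 1) ^ 2 + (m + 1) + 1) * m := by
    rw [Nat.sub_eq_iff_eq_add (Nat.one_le_pow _ _ (by omega))]; ring
  rw [h1, Nat.add_sub_cancel] at hcard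
  exact Nat.eq_of_mul_eq_mul_right (by omega) hcard

/-! ### Bose's difference bases -/

lemma exists_eq_add_mul (h2 : Module.finrank F K = 2) {u : K}
    (hu : u ∉ Set.range (algebraMap F K)) (x : K) :
    ∃ a b : F, x = algebraMap F K a + algebraMap F K b * u := by
  have : FiniteDimensional F K := FiniteDimensional.of_finrank_pos (by omega)
  let L : (F × F) →ₗ[F] K :=
    { toFun := fun x => algebraMap F K x.1 + algebraMap F K x.2 * u
      map_add' := fun x y => by
        simp only [Prod.fst_add, Prod.snd_add, map_add]; ring
      map_smul' := fun r x => by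
        simp only [Prod.smul_fst, Prod.smul_snd, smul_eq_mul, map_mul, RingHom.id_apply]
        rw [Algebra.smul_def]
        ring }
  have hL : Function.Injective L := by
    rw [injective_iff_map_eq_zero]
    rintro ⟨a, b⟩ h
    obtain ⟨rfl, rfl⟩ := eq_zero_of_add_mul_eq_zero hu h
    rfl
  obtain ⟨⟨a, b⟩, h⟩ := (LinearMap.injective_iff_surjective_of_finrank_eq_finrank
    (by simp [h2])).mp hL x
  exact ⟨a, b, h.symm⟩

lemma differenceSize_bose_le [Finite K] (h2 : Module.finrank F K = 2) :
    differenceSize (Set.univ : Set Kˣ) ≤ Nat.card F + 2 * (Nat.sqrt (Nat.card F) + 1) := by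
  classical
  have : Finite F := Finite.of_injective _ (algebraMap F K).injective
  have := Fintype.ofFinite F
  obtain ⟨θ, hθ⟩ := exists_notMem_range_algebraMap (F := F) (K := K) (by omega)
  let v : F → Kˣ := fun c => Units.mk0 _ (add_algebraMap_ne_zero hθ c)
  obtain ⟨g, hg⟩ := IsCyclic.exists_generator (α := Fˣ)
  let φ : Fˣ →* Kˣ := Units.map (algebraMap F K : F →* K)
  have hsub : (Set.univ : Set Kˣ) ⊆
      {u | (u : K) ∉ Set.range (algebraMap F K)} ∪ Subgroup.zpowers (φ g) := by
    intro u _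
    by_cases hu : (u : K) ∈ Set.range (algebraMap F K)
    · obtain ⟨c, hc⟩ := hu
      have hc0 : c ≠ 0 := by
        rintro rfl
        exact u.ne_zero (by simpa using hc.symm)
      obtain ⟨k, hk⟩ := hg (Units.mk0 c hc0)
      refine Or.inr ⟨k, ?_⟩
      change φ g ^ k = u
      rw [← map_zpow, show g ^ k = _ from hk]
      exact Units.ext hc
    · exact Or.inl hu
  have hB : differenceSize {u : Kˣ | (u : K) ∉ Set.range (algebraMap F K)} ≤ Nat.card F := by
    refine (differenceSize_le_card (Finset.univ.image v) fun u hu => ?_).trans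
      (Finset.card_image_le.trans (by simp))
    obtain ⟨a, b, hab⟩ := exists_eq_add_mul h2 hu ((1 - u) * θ)
    -- The relation `(1 - u) θ = a + b u` says that `u (θ + b) = θ - a`.
    refine ⟨v (-a), by simp, v b, by simp, ?_⟩
    rw [eq_mul_inv_iff_mul_eq]
    refine Units.ext ?_
    simp only [v, Units.val_mul, Units.val_mk0, map_neg]
    linear_combination -hab
  have hord : orderOf (φ g) ≤ Nat.card F := by
    rw [orderOf_injective φ (Units.map_injective (algebraMap F K).injective)]
    exact orderOf_le_card.trans (by rw [Nat.card_units]; omega)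
  refine (differenceSize_mono hsub).trans ((differenceSize_union_le _ _).trans
    (Nat.add_le_add hB ((differenceSize_zpowers_le _).trans ?_)))
  have := Nat.sqrt_le_sqrt hord
  omega

end Extension

/-! ### Ruzsa's difference bases -/

lemma differenceSize_ruzsa_le (p : ℕ) [Fact p.Prime] :
    differenceSize (Set.univ : Set ((ZMod p)ˣ × Multiplicative (ZMod p))) ≤
      p + 4 * (Nat.sqrt p + 1) := by
  classical
  obtain ⟨g, hg⟩ := IsCyclic.exists_generator (α := (ZMod p)ˣ)
  let z : (ZMod p)ˣ × Multiplicative (ZMod p) := (g, 1)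
  let t : (ZMod p)ˣ × Multiplicative (ZMod p) := (1, Multiplicative.ofAdd 1)
  let A : Set ((ZMod p)ˣ × Multiplicative (ZMod p)) := {x | x.1 ≠ 1 ∧ x.2 ≠ 1}
  have hsub : (Set.univ : Set ((ZMod p)ˣ × Multiplicative (ZMod p))) ⊆
      A ∪ (Subgroup.zpowers z ∪ Subgroup.zpowers t) := by
    rintro ⟨a, b⟩ -
    by_cases hb : b = 1
    · obtain ⟨k, hk⟩ := hg a
      exact Or.inr (Or.inl ⟨k, by simpa [z, hb] using hk⟩)
    by_cases ha : a = 1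
    · refine Or.inr (Or.inr ⟨(b.toAdd.val : ℤ), ?_⟩)
      refine Prod.ext (by simp [t, ha]) (Multiplicative.toAdd.injective ?_)
      simp [t]
    exact Or.inl ⟨ha, hb⟩
  have hA : differenceSize A ≤ p := by
    refine (differenceSize_le_card (Finset.univ.image
      fun x : (ZMod p)ˣ => (x, Multiplicative.ofAdd (x : ZMod p))) ?_).trans
      (Finset.card_image_le.trans ?_)
    · rintro ⟨a, b⟩ ⟨ha, hb⟩
      have ha' : (a : ZMod p) - 1 ≠ 0 := fun h =>
        ha (Units.ext (by simpa using sub_eq_zero.mp h))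
      have hb' : b.toAdd ≠ 0 := fun h => hb (Multiplicative.toAdd.injective h)
      -- `x = a * y` and `x - y = b` force `y = b / (a - 1)`, which is invertible as `b ≠ 0`.
      let y : (ZMod p)ˣ := Units.mk0 (b.toAdd / (a - 1)) (div_ne_zero hb' ha')
      refine ⟨(a * y, Multiplicative.ofAdd ((a * y : (ZMod p)ˣ) : ZMod p)), by simp,
        (y, Multiplicative.ofAdd (y : ZMod p)), by simp, ?_⟩
      refine Prod.ext (by simp) (Multiplicative.toAdd.injective ?_)
      simp only [y, Prod.snd_mul, Prod.snd_inv, toAdd_mul, toAdd_inv, toAdd_ofAdd, Units.val_mul,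
        Units.val_mk0]
      field_simp
      ring
    · rw [Finset.card_univ, ZMod.card_units]
      omega
  have hz : orderOf z ≤ p := by
    have h : orderOf z ≤ Nat.card (ZMod p)ˣ :=
      (orderOf_injective (MonoidHom.inl (ZMod p)ˣ (Multiplicative (ZMod p)))
        (fun _ _ h => congrArg Prod.fst h) g).trans_le orderOf_le_card
    rw [Nat.card_eq_fintype_card, ZMod.card_units] at h
    omega
  have ht : orderOf t ≤ p :=
    (orderOf_injective (MonoidHom.inr (ZMod p)ˣ (Multiplicative (ZMod p)))
      (fun _ _ h => congrArg Prod.snd h) (Multiplicative.ofAdd 1)).trans_le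
      (orderOf_le_card.trans (by simp))
  have h1 := Nat.sqrt_le_sqrt hz
  have h2 := Nat.sqrt_le_sqrt ht
  have h3 := differenceSize_zpowers_le z
  have h4 := differenceSize_zpowers_le t
  have h5 := differenceSize_mono hsub
  have h6 := differenceSize_union_le A (Subgroup.zpowers z ∪ Subgroup.zpowers t)
  have h7 := differenceSize_union_le (SetLike.coe (Subgroup.zpowers z)) (SetLike.coe (Subgroup.zpowers t))
  omega

/-! ### Bounds for groups of roots of unity -/

lemma exists_field_extension {q : ℕ} (hq : IsPrimePow q) (n : ℕ) [NeZero n] :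
    ∃ (F K : Type) (_ : Field F) (_ : Field K) (_ : Algebra F K),
      Finite K ∧ Nat.card F = q ∧ Module.finrank F K = n := by
  obtain ⟨p, k, hp, hk, rfl⟩ := (isPrimePow_nat_iff q).mp hq
  have : Fact p.Prime := ⟨hp⟩
  exact ⟨GaloisField p k, FiniteField.Extension (GaloisField p k) p n, inferInstance,
    inferInstance, inferInstance, inferInstance, GaloisField.card p k hk.ne',
    FiniteField.finrank_extension _ _ _⟩

lemma differenceSize_rootsOfUnity_singer_le {q : ℕ} (hq : IsPrimePow q) :
    differenceSize (Set.univ : Set (rootsOfUnity (q ^ 2 + q + 1) ℂ)) ≤ q + 4 * (Nat.sqrt q + 1) := by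
  obtain ⟨F, K, _, _, _, _, rfl, h3⟩ := exists_field_extension hq 3
  have : Finite F := Finite.of_injective _ (algebraMap F K).injective
  have : IsCyclic (Kˣ ⧸ (Units.map (algebraMap F K : F →* K)).range) :=
    isCyclic_of_surjective _ (QuotientGroup.mk'_surjective _)
  have h1 := differenceSize_rootsOfUnity_le (Nat.succ_ne_zero _) (card_units_quotient h3)
  have h2 := differenceSize_singer_le h3
  omega

lemma differenceSize_rootsOfUnity_bose_le {q : ℕ} (hq : IsPrimePow q) :
    differenceSize (Set.univ : Set (rootsOfUnity (q ^ 2 - 1) ℂ)) ≤ q + 4 * (Nat.sqrt q + 1) := by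
  have hq1 : 1 < q ^ 2 := Nat.one_lt_pow two_ne_zero hq.one_lt
  obtain ⟨F, K, _, _, _, _, rfl, h2⟩ := exists_field_extension hq 2
  have : Finite F := Finite.of_injective _ (algebraMap F K).injective
  have : Module.Finite F K := .of_finite
  have hcard : Nat.card Kˣ = Nat.card F ^ 2 - 1 := by
    rw [Nat.card_units, Module.natCard_eq_pow_finrank (K := F) (V := K), h2]
  have h1 := differenceSize_rootsOfUnity_le (by omega) hcard
  have h3 := differenceSize_bose_le h2
  omega

lemma differenceSize_rootsOfUnity_ruzsa_le {p : ℕ} (hp : p.Prime) :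
    differenceSize (Set.univ : Set (rootsOfUnity (p ^ 2 - p) ℂ)) ≤ p + 4 * (Nat.sqrt p + 1) := by
  have : Fact p.Prime := ⟨hp⟩
  have hcop : (p - 1).Coprime p :=
    (Nat.coprime_of_lt_prime (by have := hp.two_le; omega) (Nat.sub_lt hp.pos one_pos) hp).symm
  have hcu : Nat.card (ZMod p)ˣ = p - 1 := by rw [Nat.card_eq_fintype_card, ZMod.card_units]
  have hcm : Nat.card (Multiplicative (ZMod p)) = p := by simp
  have : IsCyclic ((ZMod p)ˣ × Multiplicative (ZMod p)) :=
    Group.isCyclic_prod_iff.mpr ⟨inferInstance, inferInstance, by rwa [hcu, hcm]⟩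
  have hcard : Nat.card ((ZMod p)ˣ × Multiplicative (ZMod p)) = p ^ 2 - p := by
    rw [Nat.card_prod, hcu, hcm, Nat.sub_mul, one_mul, sq]
  exact (differenceSize_rootsOfUnity_le (hcard ▸ Nat.card_pos.ne') hcard).trans
    (differenceSize_ruzsa_le p)

/-! ### Asymptotics -/

open Filter Topology

lemma one_le_cyclicDifferenceChar {n : ℕ} (hn : n ≠ 0) : 1 ≤ cyclicDifferenceChar n := by
  have : NeZero n := ⟨hn⟩
  have h := card_le_differenceSize_sq (G := rootsOfUnity n ℂ)
  rw [Complex.card_rootsOfUnity] at h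
  have hn' : (0 : ℝ) < n := by positivity
  rw [cyclicDifferenceChar, differenceChar, Set.ncard_univ, Complex.card_rootsOfUnity,
    one_le_div (Real.sqrt_pos.mpr hn')]
  exact Real.sqrt_le_iff.mpr ⟨by positivity, by exact_mod_cast h⟩

lemma tendsto_add_sqrt_div_sqrt :
    Tendsto (fun q : ℕ => ((q : ℝ) + 4 * (√q + 1)) / √((q : ℝ) ^ 2 - q)) atTop (𝓝 1) := by
  have hinv : Tendsto (fun q : ℕ => (q : ℝ)⁻¹) atTop (𝓝 0) := tendsto_inv_atTop_nhds_zero_nat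
  have hs : Tendsto (fun q : ℕ => √((q : ℝ)⁻¹)) atTop (𝓝 0) := by
    simpa only [Real.sqrt_zero] using hinv.sqrt
  have hd : Tendsto (fun q : ℕ => √(1 - (q : ℝ)⁻¹)) atTop (𝓝 1) := by
    simpa only [sub_zero, Real.sqrt_one] using (hinv.const_sub 1).sqrt
  have hlim : Tendsto (fun q : ℕ => (1 + 4 * (√((q : ℝ)⁻¹) + (q : ℝ)⁻¹)) / √(1 - (q : ℝ)⁻¹))
      atTop (𝓝 1) := by
    have h := (((hs.add hinv).const_mul 4).const_add 1).div hd one_ne_zero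
    rwa [add_zero, mul_zero, add_zero, div_one] at h
  refine hlim.congr' ?_
  filter_upwards [eventually_gt_atTop 0] with q hq
  have hq' : (0 : ℝ) < q := by exact_mod_cast hq
  have h1 : √((q : ℝ) ^ 2 - q) = q * √(1 - (q : ℝ)⁻¹) := by
    rw [show (q : ℝ) ^ 2 - q = (q : ℝ) ^ 2 * (1 - (q : ℝ)⁻¹) by field_simp,
      Real.sqrt_mul (by positivity), Real.sqrt_sq hq'.le]
  have h2 : √(q : ℝ) = q * √((q : ℝ)⁻¹) := by
    rw [Real.sqrt_inv, ← div_eq_mul_inv, Real.div_sqrt]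
  rw [h1, h2, show (q : ℝ) + 4 * (q * √((q : ℝ)⁻¹) + 1) =
    q * (1 + 4 * (√((q : ℝ)⁻¹) + (q : ℝ)⁻¹)) by field_simp, mul_div_mul_left _ _ hq'.ne']

lemma tendsto_cyclicDifferenceChar (f : ℕ → ℕ) (S : Set ℕ) (hS : ∀ q ∈ S, 2 ≤ q)
    (hf : ∀ q ∈ S, q ^ 2 ≤ f q + q)
    (hsize : ∀ q ∈ S, differenceSize (Set.univ : Set (rootsOfUnity (f q) ℂ)) ≤
      q + 4 * (Nat.sqrt q + 1)) :
    Tendsto (fun q => cyclicDifferenceChar (f q)) (atTop ⊓ 𝓟 S) (𝓝 1) := by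
  have hpos (q : ℕ) (hq : q ∈ S) : f q ≠ 0 := by
    have h1 := hf q hq
    have h2 := hS q hq
    intro h0
    rw [h0] at h1
    nlinarith
  have hmem : ∀ᶠ q in atTop ⊓ 𝓟 S, q ∈ S := eventually_inf_principal.mpr (by simp)
  refine tendsto_of_tendsto_of_tendsto_of_le_of_le' tendsto_const_nhds
    (tendsto_add_sqrt_div_sqrt.mono_left inf_le_left) ?_ ?_
  · filter_upwards [hmem] with q hq using one_le_cyclicDifferenceChar (hpos q hq)
  · filter_upwards [hmem] with q hq
    have : NeZero (f q) := ⟨hpos q hq⟩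
    have hq2 : (2 : ℝ) ≤ q := by exact_mod_cast hS q hq
    have h1 : (q : ℝ) ^ 2 - q ≤ f q := by
      have : (q : ℝ) ^ 2 ≤ f q + q := by exact_mod_cast hf q hq
      linarith
    have h2 : (differenceSize (Set.univ : Set (rootsOfUnity (f q) ℂ)) : ℝ) ≤
        q + 4 * (Nat.sqrt q + 1) := by exact_mod_cast hsize q hq
    have h3 : (Nat.sqrt q : ℝ) ≤ √q := Real.nat_sqrt_le_real_sqrt
    rw [cyclicDifferenceChar, differenceChar, Set.ncard_univ, Complex.card_rootsOfUnity]
    refine div_le_div₀ (by positivity) (by linarith) (Real.sqrt_pos.mpr (by nlinarith))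
      (Real.sqrt_le_sqrt h1)

theorem mainTheorem5 :
    Filter.Tendsto (fun q : ℕ => cyclicDifferenceChar (q ^ 2 + q + 1))
      (Filter.atTop ⊓ Filter.principal {q : ℕ | IsPrimePow q}) (nhds 1) ∧
    Filter.Tendsto (fun q : ℕ => cyclicDifferenceChar (q ^ 2 - 1))
      (Filter.atTop ⊓ Filter.principal {q : ℕ | IsPrimePow q}) (nhds 1) ∧
    Filter.Tendsto (fun p : ℕ => cyclicDifferenceChar (p ^ 2 - p))
      (Filter.atTop ⊓ Filter.principal {p : ℕ | p.Prime}) (nhds 1) := by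
  refine ⟨tendsto_cyclicDifferenceChar _ _ (fun q hq => IsPrimePow.two_le hq)
      (fun q _ => by omega) fun q hq => differenceSize_rootsOfUnity_singer_le hq,
    tendsto_cyclicDifferenceChar _ _ (fun q hq => IsPrimePow.two_le hq)
      (fun q hq => ?_) fun q hq => differenceSize_rootsOfUnity_bose_le hq,
    tendsto_cyclicDifferenceChar _ _ (fun p hp => Nat.Prime.two_le hp)
      (fun p _ => by omega) fun p hp => differenceSize_rootsOfUnity_ruzsa_le hp⟩
  have := IsPrimePow.two_le hq
  omega
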